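/- For every integer $\ell \ge 0$ there is a constant $N(\ell)$, depending only on $\ell$, such that for every $n \ge 0$ and every complete non-singular fan $\Sigma$ in $\mathbb{R}^n$ (with respect to the lattice $\mathbb{Z}^n$) of Picard number $\ell$, the number of primitive collections in $G(\Sigma)$ is at most $N(\ell)$. Here a fan is a nonempty finite collection of strongly convex rational polyhedral cones in $\mathbb{R}^n$ that contains all faces of its members and in which any two members intersect in a common face; it is complete if its cones cover $\mathbb{R}^n$, and non-singular if each of its cones is generated by a part of a $\mathbb{Z}$-basis of $\mathbb{Z}^n$. The Picard number of $\Sigma$ is $m-n$, where $m$ is the number of rays (one-dimensional cones) of $\Sigma$, and $G(\Sigma)$ is the set of the primitive lattice vectors that generate the rays of $\Sigma$. A nonempty subset $P=\{x_1,\dots,x_k\}$ of $G(\Sigma)$ is a primitive collection if $P$ does not generate a $k$-dimensional cone of $\Sigma$, while for each $i$ the set $P\setminus\{x_i\}$ generates a $(k-1)$-dimensional cone of $\Sigma$. -/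

import Mathlib

noncomputable section

/-- The inclusion of the lattice `ℤⁿ` into `ℝⁿ`. -/
def latticeVec {n : ℕ} (v : Fin n → ℤ) : Fin n → ℝ := fun i => (v i : ℝ)

/-- The dimension of a cone: the dimension of its linear span. -/
def coneDim {n : ℕ} (σ : PointedCone ℝ (Fin n → ℝ)) : ℕ :=
  Module.finrank ℝ (Submodule.span ℝ (σ : Set (Fin n → ℝ)))

/-- The cone in `ℝⁿ` generated by a finite set of lattice vectors. -/
def latticeCone {n : ℕ} (S : Finset (Fin n → ℤ)) : PointedCone ℝ (Fin n → ℝ) :=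
  PointedCone.hull ℝ (latticeVec '' (S : Set (Fin n → ℤ)))

/-- A fan in `ℝⁿ` with respect to the lattice `ℤⁿ`: a nonempty finite collection of strongly convex
rational polyhedral cones that contains every face of each of its members, and in which any two
members meet in a common face. -/
structure ToricFan (n : ℕ) where
  cones : Set (PointedCone ℝ (Fin n → ℝ))
  finite_cones : cones.Finite
  nonempty_cones : cones.Nonempty
  rational_polyhedral : ∀ σ ∈ cones, ∃ S : Finset (Fin n → ℤ), σ = latticeCone S
  strongly_convex : ∀ σ ∈ cones, ∀ x ∈ σ, -x ∈ σ → x = 0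
  face_mem : ∀ σ ∈ cones, ∀ τ : PointedCone ℝ (Fin n → ℝ), τ.IsFaceOf σ → τ ∈ cones
  inter_isFaceOf : ∀ σ ∈ cones, ∀ τ ∈ cones, (σ ⊓ τ).IsFaceOf σ ∧ (σ ⊓ τ).IsFaceOf τ

namespace ToricFan

variable {n : ℕ} (F : ToricFan n)

/-- The fan is complete: its cones cover `ℝⁿ`. -/
def IsComplete : Prop := ∀ x : Fin n → ℝ, ∃ σ ∈ F.cones, x ∈ σ

/-- The fan is non-singular: every cone is generated by a part of a basis of the lattice `ℤⁿ`. -/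
def IsNonsingular : Prop :=
  ∀ σ ∈ F.cones, ∃ (b : Module.Basis (Fin n) ℤ (Fin n → ℤ)) (I : Finset (Fin n)),
    σ = latticeCone (I.image b)

/-- The rays of the fan: its one-dimensional cones. -/
def rays : Set (PointedCone ℝ (Fin n → ℝ)) := {ρ ∈ F.cones | coneDim ρ = 1}

/-- The set `G(Σ)` of generators of the rays: the primitive lattice vectors on the rays, where a
lattice vector is primitive if it is not `k • w` for a lattice vector `w` and a non-unit `k`
(`k = 0` shows that a primitive vector is nonzero). -/
def generators : Set (Fin n → ℤ) :=
  {v | (∃ ρ ∈ F.rays, latticeVec v ∈ ρ) ∧ ∀ (k : ℤ) (w : Fin n → ℤ), v = k • w → IsUnit k}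

/-- The Picard number: the number of rays minus the dimension. -/
def picardNumber : ℤ := (F.rays.ncard : ℤ) - (n : ℤ)

/-- The set `S` generates a cone of the fan of dimension `|S|`. -/
def GeneratesCone (S : Finset (Fin n → ℤ)) : Prop :=
  latticeCone S ∈ F.cones ∧ coneDim (latticeCone S) = S.card

/-- Primitive collections in `G(Σ)`: nonempty subsets `P = {x₁, …, x_k}` of `G(Σ)` that do not
generate a `k`-dimensional cone of the fan, while for every `i` the set `P \ {x_i}` generates
a `(k - 1)`-dimensional cone of the fan. -/
def IsPrimitiveCollection (P : Finset (Fin n → ℤ)) : Prop :=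
  P.Nonempty ∧ (P : Set (Fin n → ℤ)) ⊆ F.generators ∧ ¬ F.GeneratesCone P ∧
    ∀ x ∈ P, F.GeneratesCone (P.erase x)

end ToricFan

end

/-!
The primitive collections are the minimal non-faces of the simplicial complex on `G(Σ)` whose faces
are the generating sets of the cones of `Σ`. The bound is `N(ℓ) = 2 ^ 2 ^ ℓ`.

Let `R` be the space of linear relations over `𝔽₂` between the reductions mod 2 of the vectors in
`G(Σ)`. The generators of an `n`-dimensional cone reduce to a basis of `𝔽₂ⁿ`, so `dim R = m - n = ℓ`
(`finrank_ker_modTwoMap`). A generator `v` acts on `R` by taking the coefficient of `v`; this is an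
element of the dual space of `R`, which has `2 ^ ℓ` elements (`galeDual`). If two distinct generators
`v` and `w` have the same image there, then every `n`-dimensional cone contains `v` or `w`: otherwise
expressing `v` in the basis given by the cone yields a relation that involves `v` and not `w`
(`mem_or_mem_of_galeDual_eq`).

It follows that a primitive collection `P` containing `v` contains `w`
(`IsPrimitiveCollection.mem_of_galeDual_eq`). Indeed, suppose `w ∉ P`, and extend `P \ {v}` to an
`n`-dimensional cone. As it does not contain `v`, it contains `w`, and crossing the wall opposite to
`w` leads into an `n`-dimensional cone that still contains `P \ {v}` but does not contain `w`
(`exists_erase_subset`). So this cone contains `v`, hence all of `P`, which is impossible. Therefore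
`P` is determined by its image in the dual of `R`, and there are at most `2 ^ 2 ^ ℓ` such images.

Completeness enters through `exists_add_smul_mem`: moving from a relative interior point of a cone in
any direction leads into a cone that has the first one as a face.
-/

open Module

/-! ### Lattice bases and coordinates on simplicial cones -/

/-- A `ℤ`-basis of `ℤⁿ`, reduced to a basis of `Kⁿ` for a field `K`. -/
noncomputable def castBasis (K : Type*) [Field K] {n : ℕ} (b : Basis (Fin n) ℤ (Fin n → ℤ)) :
    Basis (Fin n) K (Fin n → K) :=
  basisOfTopLeSpanOfCardEqFinrank (fun i j => (b i j : K)) (by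
    rw [← (Pi.basisFun K (Fin n)).span_eq, Submodule.span_le]
    rintro _ ⟨i, rfl⟩
    have h : Pi.basisFun K (Fin n) i =
        ∑ k, (b.repr (Pi.single i 1) k : K) • (fun j => (b k j : K)) := by
      ext j
      have := congrArg (fun x : ℤ => (x : K)) (congrFun (b.sum_repr (Pi.single i 1)) j)
      simp only [Finset.sum_apply, Pi.smul_apply, smul_eq_mul, Int.cast_sum, Int.cast_mul] at this
      simp only [Finset.sum_apply, Pi.smul_apply, smul_eq_mul, this, Pi.basisFun_apply]
      by_cases hj : j = i
      · subst hj; simp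
      · simp [hj]
    rw [h]
    exact Submodule.sum_mem _ fun k _ =>
      Submodule.smul_mem _ _ (Submodule.subset_span ⟨k, rfl⟩)) (by simp)

lemma castBasis_apply (K : Type*) [Field K] {n : ℕ} (b : Basis (Fin n) ℤ (Fin n → ℤ))
    (i j : Fin n) : castBasis K b i j = (b i j : K) := by
  simp [castBasis]

lemma castBasis_real_apply {n : ℕ} (b : Basis (Fin n) ℤ (Fin n → ℤ)) (i : Fin n) :
    castBasis ℝ b i = latticeVec (b i) :=
  funext fun j => castBasis_apply ℝ b i j

lemma latticeVec_injective {n : ℕ} : Function.Injective (latticeVec (n := n)) := fun v w h =>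
  funext fun i => by simpa [latticeVec] using congrFun h i

/-- In coordinates with respect to a lattice basis, the cone generated by some of the basis vectors
is a coordinate orthant. -/
lemma mem_latticeCone_image_iff {n : ℕ} (b : Basis (Fin n) ℤ (Fin n → ℤ)) (I : Finset (Fin n))
    (x : Fin n → ℝ) :
    x ∈ latticeCone (I.image b) ↔
      ∀ i, 0 ≤ (castBasis ℝ b).repr x i ∧ (i ∉ I → (castBasis ℝ b).repr x i = 0) := by
  constructor
  · intro hx
    unfold latticeCone PointedCone.hull at hx
    induction hx using Submodule.span_induction with
    | mem x hx =>
      obtain ⟨v, hv, rfl⟩ := hx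
      obtain ⟨k, hk, rfl⟩ := Finset.mem_image.1 (Finset.mem_coe.1 hv)
      intro i
      rw [← castBasis_real_apply, Basis.repr_self, Finsupp.single_apply]
      refine ⟨by split_ifs <;> simp, fun hi => if_neg ?_⟩
      rintro rfl
      exact hi hk
    | zero => simp
    | add x y _ _ hx hy =>
      intro i
      simp only [map_add, Finsupp.add_apply]
      exact ⟨add_nonneg (hx i).1 (hy i).1, fun hi => by rw [(hx i).2 hi, (hy i).2 hi, add_zero]⟩
    | smul a x _ hx =>
      intro i
      have : (castBasis ℝ b).repr (a • x) i = (a : ℝ) * (castBasis ℝ b).repr x i := by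
        change (castBasis ℝ b).repr ((a : ℝ) • x) i = _
        rw [map_smul, Finsupp.smul_apply, smul_eq_mul]
      rw [this]
      exact ⟨mul_nonneg a.2 (hx i).1, fun hi => by rw [(hx i).2 hi, mul_zero]⟩
  · intro h
    rw [← (castBasis ℝ b).sum_repr x]
    refine Submodule.sum_mem _ fun i _ => ?_
    by_cases hi : i ∈ I
    · refine PointedCone.smul_mem _ (h i).1 (Submodule.subset_span ⟨b i, ?_, ?_⟩)
      · simpa using ⟨i, hi, rfl⟩
      · rw [castBasis_real_apply]
    · rw [(h i).2 hi, zero_smul]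
      exact Submodule.zero_mem _

lemma isClosed_latticeCone_image {n : ℕ} (b : Basis (Fin n) ℤ (Fin n → ℤ)) (I : Finset (Fin n)) :
    IsClosed (latticeCone (I.image b) : Set (Fin n → ℝ)) := by
  have hc : ∀ i, Continuous fun x => (castBasis ℝ b).repr x i := fun i =>
    ((castBasis ℝ b).coord i).continuous_of_finiteDimensional
  have : (latticeCone (I.image b) : Set (Fin n → ℝ)) =
      ⋂ i, {x | 0 ≤ (castBasis ℝ b).repr x i} ∩ {x | i ∉ I → (castBasis ℝ b).repr x i = 0} := by
    ext x
    simp [mem_latticeCone_image_iff]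
  rw [this]
  refine isClosed_iInter fun i => (isClosed_le continuous_const (hc i)).inter ?_
  by_cases hi : i ∈ I
  · simp [hi]
  · simpa [hi] using isClosed_eq (hc i) continuous_const

lemma isFaceOf_latticeCone_image {n : ℕ} (b : Basis (Fin n) ℤ (Fin n → ℤ)) {I J : Finset (Fin n)}
    (h : J ⊆ I) : (latticeCone (J.image b)).IsFaceOf (latticeCone (I.image b)) where
  le := Submodule.span_mono (Set.image_mono (by exact_mod_cast Finset.image_subset_image h))
  mem_of_smul_add_mem {x y a} hx hy ha hxy := by
    rw [mem_latticeCone_image_iff] at *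
    intro i
    refine ⟨(hx i).1, fun hi => ?_⟩
    have := (hxy i).2 hi
    simp only [map_add, map_smul, Finsupp.add_apply, Finsupp.smul_apply, smul_eq_mul] at this
    have h1 := (hx i).1
    have h2 := (hy i).1
    have h3 := mul_nonneg ha.le h1
    have h4 : a * (castBasis ℝ b).repr x i = 0 := by linarith
    exact (mul_eq_zero.1 h4).resolve_left ha.ne'

lemma coneDim_latticeCone_image {n : ℕ} (b : Basis (Fin n) ℤ (Fin n → ℤ)) (I : Finset (Fin n)) :
    coneDim (latticeCone (I.image b)) = I.card := by
  have hli : LinearIndependent ℝ fun i : I => castBasis ℝ b i :=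
    (castBasis ℝ b).linearIndependent.comp _ Subtype.val_injective
  have h := finrank_span_eq_card hli
  rw [Fintype.card_coe] at h
  have hr : (Set.range fun i : I => castBasis ℝ b i) =
      latticeVec '' ((I.image b : Finset (Fin n → ℤ)) : Set (Fin n → ℤ)) := by
    ext x
    simp [castBasis_real_apply]
  have hs : Submodule.span ℝ (latticeCone (I.image b) : Set (Fin n → ℝ)) =
      Submodule.span ℝ (Set.range fun i : I => castBasis ℝ b i) := by
    rw [hr]
    exact le_antisymm (Submodule.span_le.2 fun x hx => PointedCone.hull_le_span ℝ _ hx)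
      (Submodule.span_mono Submodule.subset_span)
  rw [coneDim, hs, h]

lemma latticeVec_mem_latticeCone {n : ℕ} {S : Finset (Fin n → ℤ)} {v : Fin n → ℤ} (hv : v ∈ S) :
    latticeVec v ∈ latticeCone S :=
  Submodule.subset_span ⟨v, hv, rfl⟩

/-- A lattice vector is primitive if it is not a multiple by a non-unit. -/
def IsPrimitiveVec {n : ℕ} (v : Fin n → ℤ) : Prop :=
  ∀ (k : ℤ) (w : Fin n → ℤ), v = k • w → IsUnit k

lemma isPrimitiveVec_basis {n : ℕ} (b : Basis (Fin n) ℤ (Fin n → ℤ)) (i : Fin n) :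
    IsPrimitiveVec (b i) := by
  intro k w h
  have : (1 : ℤ) = k * b.repr w i := by
    have := congrArg (fun v => b.repr v i) h
    simpa only [map_smul, Finsupp.smul_apply, smul_eq_mul, Basis.repr_self,
      Finsupp.single_eq_same] using this
  exact IsUnit.of_mul_eq_one _ this.symm

/-- Reduction commutes with taking coordinates. -/
lemma castBasis_repr (K : Type*) [Field K] {n : ℕ} (b : Basis (Fin n) ℤ (Fin n → ℤ))
    (v : Fin n → ℤ) (i : Fin n) :
    (castBasis K b).repr (fun j => (v j : K)) i = (b.repr v i : K) := by
  have : (fun j => (v j : K)) = ∑ k, (b.repr v k : K) • castBasis K b k := by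
    ext j
    have := congrArg (fun x : ℤ => (x : K)) (congrFun (b.sum_repr v) j)
    simp only [Finset.sum_apply, Pi.smul_apply, smul_eq_mul, Int.cast_sum, Int.cast_mul] at this
    simp only [Finset.sum_apply, Pi.smul_apply, smul_eq_mul, castBasis_apply, this]
  rw [this, Basis.repr_sum_self]

/-- A primitive vector on the ray spanned by a basis vector is that basis vector. -/
lemma IsPrimitiveVec.eq_of_mem_ray {n : ℕ} (b : Basis (Fin n) ℤ (Fin n → ℤ)) (i : Fin n)
    {v : Fin n → ℤ} (hv : IsPrimitiveVec v) (h : latticeVec v ∈ latticeCone {b i}) : v = b i := by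
  rw [← Finset.image_singleton, mem_latticeCone_image_iff] at h
  have hr : ∀ j, (castBasis ℝ b).repr (latticeVec v) j = (b.repr v j : ℝ) := castBasis_repr ℝ b v
  simp only [hr] at h
  have hz : v = b.repr v i • b i := by
    conv_lhs => rw [← b.sum_repr v]
    rw [Finset.sum_eq_single i]
    · intro j _ hj
      have := (h j).2 (by simpa using hj)
      rw [Int.cast_eq_zero.1 this, zero_smul]
    · simp
  have hn : 0 ≤ b.repr v i := by exact_mod_cast (h i).1
  rcases Int.isUnit_iff.1 (hv _ _ hz) with h1 | h1
  · rw [hz, h1, one_smul]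
  · omega

/-! ### The simplicial complex of a complete non-singular fan -/

namespace ToricFan

variable {n : ℕ} {F : ToricFan n}

/-- `S` spans a cone of the fan and is part of a lattice basis: for a non-singular fan, these are
the faces of the simplicial complex on the ray generators. -/
def IsSimplex (F : ToricFan n) (S : Finset (Fin n → ℤ)) : Prop :=
  latticeCone S ∈ F.cones ∧
    ∃ (b : Basis (Fin n) ℤ (Fin n → ℤ)) (I : Finset (Fin n)), I.image b = S

lemma IsNonsingular.exists_isSimplex (hF : F.IsNonsingular)
    {σ : PointedCone ℝ (Fin n → ℝ)} (hσ : σ ∈ F.cones) :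
    ∃ S, F.IsSimplex S ∧ latticeCone S = σ := by
  obtain ⟨b, I, rfl⟩ := hF σ hσ
  exact ⟨_, ⟨hσ, b, I, rfl⟩, rfl⟩

namespace IsSimplex

variable {S T : Finset (Fin n → ℤ)}

lemma card_le (h : F.IsSimplex S) : S.card ≤ n := by
  obtain ⟨-, b, I, rfl⟩ := h
  exact Finset.card_image_le.trans ((Finset.card_le_univ I).trans (by simp))

lemma coneDim_eq (h : F.IsSimplex S) : coneDim (latticeCone S) = S.card := by
  obtain ⟨-, b, I, rfl⟩ := h
  rw [coneDim_latticeCone_image, Finset.card_image_of_injective _ b.injective]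

lemma generatesCone (h : F.IsSimplex S) : F.GeneratesCone S := ⟨h.1, h.coneDim_eq⟩

lemma isFaceOf_of_subset (h : F.IsSimplex S) (hT : T ⊆ S) :
    (latticeCone T).IsFaceOf (latticeCone S) := by
  obtain ⟨-, b, I, rfl⟩ := h
  obtain ⟨J, hJ, rfl⟩ := Finset.subset_image_iff.1 hT
  exact isFaceOf_latticeCone_image b hJ

lemma mono (h : F.IsSimplex S) (hT : T ⊆ S) : F.IsSimplex T := by
  refine ⟨F.face_mem _ h.1 _ (h.isFaceOf_of_subset hT), ?_⟩
  obtain ⟨-, b, I, rfl⟩ := h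
  obtain ⟨J, -, rfl⟩ := Finset.subset_image_iff.1 hT
  exact ⟨b, J, rfl⟩

lemma isPrimitiveVec (h : F.IsSimplex S) {v : Fin n → ℤ} (hv : v ∈ S) : IsPrimitiveVec v := by
  obtain ⟨-, b, I, rfl⟩ := h
  obtain ⟨i, -, rfl⟩ := Finset.mem_image.1 hv
  exact isPrimitiveVec_basis b i

/-- The only primitive vectors spanning rays of a simplicial cone are its given generators. -/
lemma mem_of_isFaceOf (hT : F.IsSimplex T) {s : Fin n → ℤ} (hs : IsPrimitiveVec s)
    (h : (latticeCone {s}).IsFaceOf (latticeCone T)) (hsi : F.IsSimplex {s}) : s ∈ T := by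
  obtain ⟨-, b, I, rfl⟩ := hT
  have hsT : latticeVec s ∈ latticeCone (I.image b) :=
    h.le (latticeVec_mem_latticeCone (Finset.mem_singleton_self s))
  have hc := (mem_latticeCone_image_iff b I _).1 hsT
  obtain ⟨i, hi⟩ : ∃ i, (castBasis ℝ b).repr (latticeVec s) i ≠ 0 := by
    by_contra! h0
    have hz : (castBasis ℝ b).repr (latticeVec s) = 0 := Finsupp.ext h0
    rw [LinearEquiv.map_eq_zero_iff] at hz
    have : s = 0 := latticeVec_injective (hz.trans (by ext; simp [latticeVec]))
    exact not_isUnit_zero (hs 0 0 (by simpa using this))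
  have hiI : i ∈ I := by
    by_contra hiI
    exact hi ((hc i).2 hiI)
  -- all coordinates are nonnegative, so the summand of `s` along `b i` lies in the face spanned
  -- by `s`
  have hmem : latticeVec (b i) ∈ latticeCone {s} := by
    rw [← castBasis_real_apply]
    refine h.mem_of_smul_add_mem (a := (castBasis ℝ b).repr (latticeVec s) i)
      (y := ∑ j ∈ Finset.univ.erase i, (castBasis ℝ b).repr (latticeVec s) j • castBasis ℝ b j)
      ?_ ?_ (lt_of_le_of_ne (hc i).1 hi.symm) ?_
    · rw [castBasis_real_apply]
      exact latticeVec_mem_latticeCone (Finset.mem_image_of_mem _ hiI)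
    · refine Submodule.sum_mem _ fun j _ => ?_
      by_cases hj : j ∈ I
      · rw [castBasis_real_apply]
        exact PointedCone.smul_mem _ (hc j).1
          (latticeVec_mem_latticeCone (Finset.mem_image_of_mem _ hj))
      · rw [(hc j).2 hj, zero_smul]
        exact Submodule.zero_mem _
    · have hsum : (castBasis ℝ b).repr (latticeVec s) i • castBasis ℝ b i +
          ∑ j ∈ Finset.univ.erase i, (castBasis ℝ b).repr (latticeVec s) j • castBasis ℝ b j =
          latticeVec s :=
        (Finset.add_sum_erase _ (fun j => (castBasis ℝ b).repr (latticeVec s) j • castBasis ℝ b j)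
          (Finset.mem_univ i)).trans ((castBasis ℝ b).sum_repr _)
      rw [hsum]
      exact latticeVec_mem_latticeCone (Finset.mem_singleton_self s)
  obtain ⟨-, b', J, hJ⟩ := hsi
  obtain ⟨k, -, hk⟩ := Finset.mem_image.1 (hJ ▸ Finset.mem_singleton_self s)
  subst hk
  rw [← (isPrimitiveVec_basis b i).eq_of_mem_ray b' k hmem]
  exact Finset.mem_image_of_mem _ hiI

/-- If a cone of the fan contains a point of the relative interior of another one, then it contains
that cone as a face. -/
lemma subset_of_sum_mem (hS : F.IsSimplex S) (hT : F.IsSimplex T)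
    (h : ∑ s ∈ S, latticeVec s ∈ latticeCone T) : S ⊆ T := by
  obtain ⟨h1, h2⟩ := F.inter_isFaceOf _ hS.1 _ hT.1
  have hmem : ∀ s ∈ S, latticeVec s ∈ latticeCone S := fun s hs => latticeVec_mem_latticeCone hs
  have hsum : ∑ s : S, latticeVec (s : Fin n → ℤ) ∈ latticeCone S ⊓ latticeCone T := by
    rw [Finset.sum_coe_sort S latticeVec]
    exact ⟨Submodule.sum_mem _ hmem, h⟩
  have hle : latticeCone S ≤ latticeCone S ⊓ latticeCone T := by
    refine Submodule.span_le.2 ?_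
    rintro _ ⟨s, hs, rfl⟩
    exact h1.mem_of_sum_mem (f := fun s : S => latticeVec (s : Fin n → ℤ))
      (fun s => hmem s s.2) hsum ⟨s, hs⟩
  have heq : latticeCone S ⊓ latticeCone T = latticeCone S := le_antisymm inf_le_left hle
  rw [heq] at h2
  intro s hs
  have hsub : {s} ⊆ S := Finset.singleton_subset_iff.2 hs
  exact hT.mem_of_isFaceOf (hS.isPrimitiveVec hs)
    ((hS.isFaceOf_of_subset hsub).trans h2) (hS.mono hsub)

/-- Moving slightly from a point in the relative interior of a cone of a complete fan, in any
direction, leads into a cone that contains the first one. -/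
lemma exists_add_smul_mem (hS : F.IsSimplex S) (hc : F.IsComplete) (hns : F.IsNonsingular)
    (d : Fin n → ℝ) :
    ∃ T, F.IsSimplex T ∧ S ⊆ T ∧ ∃ ε > (0 : ℝ), ∑ s ∈ S, latticeVec s + ε • d ∈ latticeCone T := by
  set p := ∑ s ∈ S, latticeVec s
  have hev : ∃ᶠ ε : ℝ in nhdsWithin 0 (Set.Ioi 0), ∃ σ ∈ F.cones, p + ε • d ∈ σ :=
    (Filter.Eventually.of_forall fun ε => hc _).frequently
  -- finitely many cones, so one of them is met for arbitrarily small parameters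
  obtain ⟨σ, hσ, hfr⟩ := (Filter.frequently_exists_finite F.finite_cones).1 hev
  obtain ⟨T, hT, rfl⟩ := hns.exists_isSimplex hσ
  have hclosed : IsClosed (latticeCone T : Set (Fin n → ℝ)) := by
    obtain ⟨-, b, I, rfl⟩ := hT
    exact isClosed_latticeCone_image b I
  have htend : Filter.Tendsto (fun ε : ℝ => p + ε • d) (nhdsWithin 0 (Set.Ioi 0)) (nhds p) := by
    have : Continuous fun ε : ℝ => p + ε • d := by fun_prop
    simpa using (this.tendsto 0).mono_left nhdsWithin_le_nhds
  have hp : p ∈ latticeCone T := hclosed.mem_of_frequently_of_tendsto hfr htend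
  obtain ⟨ε, hε, hpos⟩ := (hfr.and_eventually self_mem_nhdsWithin).exists
  exact ⟨T, hT, hS.subset_of_sum_mem hT hp, ε, hpos, hε⟩

/-- Every cone of a complete non-singular fan is a face of a full-dimensional one. -/
lemma exists_superset_card_eq (hS : F.IsSimplex S) (hc : F.IsComplete) (hns : F.IsNonsingular) :
    ∃ T, F.IsSimplex T ∧ S ⊆ T ∧ T.card = n := by
  induction hk : n - S.card using Nat.strong_induction_on generalizing S with
  | _ k ih =>
    by_cases hSn : S.card = n
    · exact ⟨S, hS, subset_rfl, hSn⟩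
    obtain ⟨b, I, hI⟩ := hS.2
    obtain ⟨j, hj⟩ : ∃ j, j ∉ I := by
      by_contra! hall
      apply hSn
      rw [← hI, Finset.card_image_of_injective _ b.injective,
        Finset.eq_univ_iff_forall.2 hall, Finset.card_univ, Fintype.card_fin]
    obtain ⟨T, hT, hST, ε, hε, hmem⟩ := hS.exists_add_smul_mem hc hns (latticeVec (b j))
    have hne : S ≠ T := by
      rintro rfl
      have hp : ∑ s ∈ S, latticeVec s ∈ latticeCone S :=
        Submodule.sum_mem _ fun s hs => latticeVec_mem_latticeCone hs
      rw [← hI, mem_latticeCone_image_iff] at hmem hp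
      have h1 := (hmem j).2 hj
      have h2 := (hp j).2 hj
      rw [hI] at h1 h2
      simp only [map_add, map_smul, Finsupp.add_apply, Finsupp.smul_apply, h2,
        ← castBasis_real_apply, Basis.repr_self, Finsupp.single_eq_same] at h1
      simp at h1
      exact hε.ne' h1
    have hlt := Finset.card_lt_card (hST.ssubset_of_ne hne)
    have hle := hT.card_le
    obtain ⟨U, hU, hTU, hcard⟩ := ih (n - T.card) (by omega) hT rfl
    exact ⟨U, hU, hST.trans hTU, hcard⟩

/-- Crossing the wall opposite to a generator `w` of a full-dimensional cone leads into another
full-dimensional cone, which does not contain `w`. -/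
lemma exists_erase_subset (hT : F.IsSimplex T) (hc : F.IsComplete) (hns : F.IsNonsingular)
    (hcard : T.card = n) {w : Fin n → ℤ} (hw : w ∈ T) :
    ∃ U, F.IsSimplex U ∧ U.card = n ∧ T.erase w ⊆ U ∧ w ∉ U := by
  obtain ⟨U, hU, hsub, ε, hε, hmem⟩ :=
    (hT.mono (T.erase_subset w)).exists_add_smul_mem hc hns (-latticeVec w)
  have hUT : ¬ U ⊆ T := by
    intro h
    have hm := (hT.isFaceOf_of_subset h).le hmem
    have hp : ∑ s ∈ T.erase w, latticeVec s ∈ latticeCone (T.erase w) :=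
      Submodule.sum_mem _ fun s hs => latticeVec_mem_latticeCone hs
    obtain ⟨-, b, I, rfl⟩ := hT
    obtain ⟨j, hj, rfl⟩ := Finset.mem_image.1 hw
    rw [← Finset.image_erase b.injective] at hp hm
    have h1 := ((mem_latticeCone_image_iff b _ _).1 hm j).1
    have h2 := ((mem_latticeCone_image_iff b _ _).1 hp j).2 (by simp)
    simp only [map_add, map_smul, map_neg, Finsupp.add_apply, Finsupp.smul_apply,
      Finsupp.neg_apply, h2, ← castBasis_real_apply, Basis.repr_self,
      Finsupp.single_eq_same, smul_eq_mul] at h1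
    linarith
  refine ⟨U, hU, ?_, hsub, fun hwU => hUT ?_⟩
  · by_contra hne
    refine hUT (?_ : U ⊆ T)
    have hlt : U.card < n := lt_of_le_of_ne hU.card_le hne
    rw [← Finset.eq_of_subset_of_card_le hsub (by rw [Finset.card_erase_of_mem hw]; omega)]
    exact T.erase_subset w
  · have hTU : T ⊆ U := by
      rw [← Finset.insert_erase hw]
      exact Finset.insert_subset hwU hsub
    exact (Finset.eq_of_subset_of_card_le hTU (hcard.symm ▸ hU.card_le)).ge

end IsSimplex
end ToricFan

/-! ### Generators of the rays -/

namespace ToricFan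

variable {n : ℕ} {F : ToricFan n}

lemma IsNonsingular.mem_generators_iff (hns : F.IsNonsingular) {v : Fin n → ℤ} :
    v ∈ F.generators ↔ F.IsSimplex {v} := by
  constructor
  · rintro ⟨⟨ρ, ⟨hρ, hdim⟩, hv⟩, hprim⟩
    obtain ⟨S, hS, rfl⟩ := hns.exists_isSimplex hρ
    rw [hS.coneDim_eq, Finset.card_eq_one] at hdim
    obtain ⟨u, rfl⟩ := hdim
    obtain ⟨-, b, I, hI⟩ := id hS
    obtain ⟨i, -, rfl⟩ := Finset.mem_image.1 (hI ▸ Finset.mem_singleton_self u)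
    rwa [IsPrimitiveVec.eq_of_mem_ray b i hprim hv]
  · intro h
    have hv := Finset.mem_singleton_self v
    exact ⟨⟨_, ⟨h.1, by simp [h.coneDim_eq]⟩, latticeVec_mem_latticeCone hv⟩, h.isPrimitiveVec hv⟩

lemma IsSimplex.subset_generators {S : Finset (Fin n → ℤ)} (hS : F.IsSimplex S)
    (hns : F.IsNonsingular) : (S : Set (Fin n → ℤ)) ⊆ F.generators := fun _ hv =>
  hns.mem_generators_iff.2 (hS.mono (Finset.singleton_subset_iff.2 hv))

lemma GeneratesCone.isSimplex {S : Finset (Fin n → ℤ)} (h : F.GeneratesCone S)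
    (hns : F.IsNonsingular) (hS : (S : Set (Fin n → ℤ)) ⊆ F.generators) : F.IsSimplex S := by
  obtain ⟨T, hT, hTS⟩ := hns.exists_isSimplex h.1
  have hsub : S ⊆ T := fun s hs =>
    (hns.mem_generators_iff.1 (hS hs)).subset_of_sum_mem hT
      (by simpa [hTS] using latticeVec_mem_latticeCone hs) (Finset.mem_singleton_self s)
  have hcard : T.card = S.card := by rw [← hT.coneDim_eq, hTS, h.2]
  rwa [Finset.eq_of_subset_of_card_le hsub hcard.le]

lemma IsNonsingular.bijOn_generators_rays (hns : F.IsNonsingular) :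
    Set.BijOn (fun v => latticeCone {v}) F.generators F.rays := by
  refine ⟨fun v hv => ?_, fun u hu v hv huv => ?_, fun ρ hρ => ?_⟩
  · have h := hns.mem_generators_iff.1 hv
    exact ⟨h.1, by simp [h.coneDim_eq]⟩
  · have huv : latticeCone {u} = latticeCone {v} := huv
    have := (hns.mem_generators_iff.1 hu).subset_of_sum_mem (hns.mem_generators_iff.1 hv)
      (by simpa [← huv] using latticeVec_mem_latticeCone (Finset.mem_singleton_self u))
    simpa using this
  · obtain ⟨S, hS, rfl⟩ := hns.exists_isSimplex hρ.1
    have hdim := hρ.2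
    rw [hS.coneDim_eq, Finset.card_eq_one] at hdim
    obtain ⟨u, rfl⟩ := hdim
    exact ⟨u, hns.mem_generators_iff.2 hS, rfl⟩

lemma IsNonsingular.finite_generators (hns : F.IsNonsingular) : F.generators.Finite := by
  refine Set.Finite.of_finite_image ?_ hns.bijOn_generators_rays.injOn
  rw [hns.bijOn_generators_rays.image_eq]
  exact F.finite_cones.subset (Set.sep_subset _ _)

lemma IsNonsingular.ncard_generators (hns : F.IsNonsingular) :
    F.generators.ncard = F.rays.ncard := by
  rw [← hns.bijOn_generators_rays.image_eq, hns.bijOn_generators_rays.injOn.ncard_image]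

lemma exists_isSimplex_card_eq (hc : F.IsComplete) (hns : F.IsNonsingular) :
    ∃ T, F.IsSimplex T ∧ T.card = n := by
  obtain ⟨σ, hσ⟩ := F.nonempty_cones
  obtain ⟨S, hS, -⟩ := hns.exists_isSimplex hσ
  obtain ⟨T, hT, -, h⟩ := hS.exists_superset_card_eq hc hns
  exact ⟨T, hT, h⟩

lemma IsSimplex.exists_basis {T : Finset (Fin n → ℤ)} (hT : F.IsSimplex T) (h : T.card = n) :
    ∃ b : Basis (Fin n) ℤ (Fin n → ℤ), Finset.univ.image b = T := by
  obtain ⟨-, b, I, rfl⟩ := hT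
  refine ⟨b, ?_⟩
  rw [Finset.card_image_of_injective _ b.injective] at h
  rw [(Finset.card_eq_iff_eq_univ I).1 (by simpa using h)]

/-! ### The Gale dual mod 2 and primitive collections -/

section ModTwo

variable [Fintype F.generators]

/-- The map `𝔽₂^{G(Σ)} → 𝔽₂ⁿ` sending the unit vector of a generator to its reduction mod 2. -/
def modTwoMap (F : ToricFan n) [Fintype F.generators] :
    (F.generators → ZMod 2) →ₗ[ZMod 2] (Fin n → ZMod 2) :=
  Fintype.linearCombination (ZMod 2) fun (v : F.generators) j => (v.1 j : ZMod 2)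

/-- The Gale dual of the generators mod 2: `v` acts on a linear relation between the reductions of
the generators by taking the coefficient of `v`. -/
def galeDual (F : ToricFan n) [Fintype F.generators] (v : F.generators) :
    Dual (ZMod 2) (LinearMap.ker F.modTwoMap) :=
  LinearMap.proj v ∘ₗ (LinearMap.ker F.modTwoMap).subtype

lemma modTwoMap_single (v : F.generators) (c : ZMod 2) :
    F.modTwoMap (Pi.single v c) = c • fun j => (v.1 j : ZMod 2) := by
  simp [modTwoMap, Fintype.linearCombination_apply_single]

lemma range_modTwoMap (hc : F.IsComplete) (hns : F.IsNonsingular) :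
    LinearMap.range F.modTwoMap = ⊤ := by
  obtain ⟨T, hT, hcard⟩ := F.exists_isSimplex_card_eq hc hns
  obtain ⟨b, rfl⟩ := hT.exists_basis hcard
  rw [eq_top_iff, ← (castBasis (ZMod 2) b).span_eq, Submodule.span_le]
  rintro _ ⟨i, rfl⟩
  refine ⟨Pi.single ⟨b i, hT.subset_generators hns (by simp)⟩ 1, ?_⟩
  rw [modTwoMap_single, one_smul]
  exact funext fun j => (castBasis_apply _ b i j).symm

lemma finrank_ker_modTwoMap (hc : F.IsComplete) (hns : F.IsNonsingular) :
    (finrank (ZMod 2) (LinearMap.ker F.modTwoMap) : ℤ) = F.picardNumber := by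
  have h := LinearMap.finrank_range_add_finrank_ker F.modTwoMap
  rw [range_modTwoMap hc hns, finrank_top, finrank_fin_fun, finrank_fintype_fun_eq_card,
    ← Nat.card_eq_fintype_card, Nat.card_coe_set_eq, hns.ncard_generators] at h
  rw [picardNumber]
  omega

/-- If two generators both lie outside a full-dimensional cone, then expressing one of them in the
basis given by this cone yields a relation that involves it but not the other. -/
lemma IsSimplex.mem_or_mem_of_galeDual_eq {T : Finset (Fin n → ℤ)} (hT : F.IsSimplex T)
    (hns : F.IsNonsingular) (hcard : T.card = n) {v w : F.generators} (hne : v ≠ w)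
    (h : F.galeDual v = F.galeDual w) : v.1 ∈ T ∨ w.1 ∈ T := by
  by_contra! hvw
  obtain ⟨b, hb⟩ := hT.exists_basis hcard
  have hbT : ∀ i, b i ∈ T := fun i => hb ▸ Finset.mem_image_of_mem b (Finset.mem_univ i)
  let g : Fin n → F.generators := fun i => ⟨b i, hT.subset_generators hns (hbT i)⟩
  have hg : ∀ u : F.generators, u.1 ∉ T → ∀ i, u ≠ g i := by
    rintro u hu i rfl
    exact hu (hbT i)
  let a : F.generators → ZMod 2 :=
    Pi.single v 1 - ∑ i, Pi.single (g i) (b.repr v.1 i : ZMod 2)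
  have ha : a ∈ LinearMap.ker F.modTwoMap := by
    rw [LinearMap.mem_ker, map_sub, map_sum, sub_eq_zero]
    simp only [modTwoMap_single, one_smul]
    rw [← (castBasis (ZMod 2) b).sum_repr fun j => (v.1 j : ZMod 2)]
    refine Finset.sum_congr rfl fun i _ => ?_
    rw [castBasis_repr]
    congr 1
    exact funext fun j => castBasis_apply _ b i j
  have hval : ∀ u : F.generators, u.1 ∉ T →
      a u = (Pi.single v 1 : F.generators → ZMod 2) u := by
    intro u hu
    simp only [a, Pi.sub_apply, Finset.sum_apply]
    rw [Finset.sum_eq_zero fun i _ => Pi.single_eq_of_ne (hg u hu i) _, sub_zero]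
  have heq : a v = a w := LinearMap.congr_fun h ⟨a, ha⟩
  rw [hval v hvw.1, hval w hvw.2, Pi.single_eq_same, Pi.single_eq_of_ne hne.symm] at heq
  exact one_ne_zero heq

/-- Primitive collections are unions of fibres of the Gale dual mod 2. -/
lemma IsPrimitiveCollection.mem_of_galeDual_eq {P : Finset (Fin n → ℤ)}
    (hP : F.IsPrimitiveCollection P) (hc : F.IsComplete) (hns : F.IsNonsingular)
    {v w : F.generators} (h : F.galeDual v = F.galeDual w) (hv : v.1 ∈ P) : w.1 ∈ P := by
  by_contra hw
  have hne : v ≠ w := by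
    rintro rfl
    exact hw hv
  obtain ⟨-, hPG, hPn, hPe⟩ := hP
  -- a cone containing `P.erase v` cannot contain `v` as well
  have hnot : ∀ U, F.IsSimplex U → P.erase v.1 ⊆ U → v.1 ∉ U := fun U hU hPU hvU =>
    hPn (hU.mono (Finset.insert_erase hv ▸ Finset.insert_subset hvU hPU)).generatesCone
  have hS : F.IsSimplex (P.erase v.1) :=
    (hPe _ hv).isSimplex hns (subset_trans (by exact_mod_cast P.erase_subset v.1) hPG)
  obtain ⟨T, hT, hST, hTc⟩ := hS.exists_superset_card_eq hc hns
  have hwT := (hT.mem_or_mem_of_galeDual_eq hns hTc hne h).resolve_left (hnot T hT hST)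
  obtain ⟨U, hU, hUc, hTU, hwU⟩ := hT.exists_erase_subset hc hns hTc hwT
  have hvU := (hU.mem_or_mem_of_galeDual_eq hns hUc hne h).resolve_right hwU
  refine hnot U hU (fun x hx => hTU (Finset.mem_erase.2 ⟨?_, hST hx⟩)) hvU
  rintro rfl
  exact hw (Finset.mem_of_mem_erase hx)

lemma injOn_image_galeDual (hc : F.IsComplete) (hns : F.IsNonsingular) :
    Set.InjOn (fun P : Finset (Fin n → ℤ) => F.galeDual '' {v | v.1 ∈ P})
      {P | F.IsPrimitiveCollection P} := by
  have key : ∀ P Q : Finset (Fin n → ℤ), F.IsPrimitiveCollection P → F.IsPrimitiveCollection Q →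
      F.galeDual '' {v | v.1 ∈ P} = F.galeDual '' {v | v.1 ∈ Q} → P ⊆ Q := by
    intro P Q hP hQ h x hx
    obtain ⟨u, hu, hux⟩ := h ▸ Set.mem_image_of_mem F.galeDual
      (show (⟨x, hP.2.1 hx⟩ : F.generators) ∈ {v : F.generators | v.1 ∈ P} from hx)
    exact hQ.mem_of_galeDual_eq hc hns hux hu
  exact fun P hP Q hQ h => (key P Q hP hQ h).antisymm (key Q P hQ hP h.symm)

end ModTwo

end ToricFan

/-- There is a function `N` such that every complete non-singular fan of Picard number `ℓ`, of any
dimension `n`, has at most `N ℓ` primitive collections. -/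
theorem corollary2p5 :
    ∃ N : ℕ → ℕ, ∀ (ℓ n : ℕ) (F : ToricFan n), F.IsComplete → F.IsNonsingular →
      F.picardNumber = (ℓ : ℤ) →
      {P : Finset (Fin n → ℤ) | F.IsPrimitiveCollection P}.encard ≤ (N ℓ : ℕ∞) := by
  refine ⟨fun ℓ => 2 ^ 2 ^ ℓ, fun ℓ n F hc hns hℓ => ?_⟩
  have : Fintype F.generators := hns.finite_generators.fintype
  let D := Dual (ZMod 2) (LinearMap.ker F.modTwoMap)
  have : Finite D := Module.finite_of_finite (ZMod 2)
  have : Fintype D := Fintype.ofFinite D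
  have hD : Fintype.card D = 2 ^ ℓ := by
    have hrank : finrank (ZMod 2) (LinearMap.ker F.modTwoMap) = ℓ := by
      exact_mod_cast (F.finrank_ker_modTwoMap hc hns).trans hℓ
    rw [Module.card_eq_pow_finrank (K := ZMod 2), Subspace.dual_finrank_eq, hrank, ZMod.card]
  calc _ ≤ (Set.univ : Set (Set D)).encard :=
        Set.encard_le_encard_of_injOn (Set.mapsTo_univ _ _) (ToricFan.injOn_image_galeDual hc hns)
    _ = ((2 ^ 2 ^ ℓ : ℕ) : ℕ∞) := by
        rw [Set.encard_univ, ENat.card_eq_coe_fintype_card, Fintype.card_set, hD]
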